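/- For a finite graph $G$, let the distinguishing threshold $\theta(G)$ be the least positive integer $t$ such that for every $k\ge t$, every vertex coloring of $G$ using exactly $k$ colors is distinguishing, i.e. is preserved by no non-identity automorphism of $G$. Write $|G|$ for the number of vertices of $G$, $\square$ for the Cartesian product of graphs, and $G^t$ for the $t$-th Cartesian power. A graph is prime if it is not the Cartesian product of two graphs neither of which is isomorphic to it. **Theorem.** Let $G$ be a finite connected graph, decomposed into prime factors as $G\cong G_1^{t_1}\,\square\, G_2^{t_2}\,\square\cdots\square\, G_k^{t_k}$, where $k\ge 1$, $t_1,\dots,t_k\ge 1$, and $G_1,\dots,G_k$ are pairwise non-isomorphic prime graphs. Then $$\theta(G)=\max\left\{\left(\theta\!\left(G_i^{t_i}\right)-1\right)\cdot\frac{|G|}{\left|G_i^{t_i}\right|}\;:\; i=1,\dots,k\right\}+1 .$$ -/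

import Mathlib

universe u v w

namespace SimpleGraph

/-- The Cartesian product of a family of graphs: two vertices are adjacent iff they form an edge
in one coordinate and agree in all the other ones. -/
def cartProd {ι : Type u} {V : ι → Type v} (G : ∀ i, SimpleGraph (V i)) :
    SimpleGraph (∀ i, V i) where
  Adj x y := ∃ i, (G i).Adj (x i) (y i) ∧ ∀ j, j ≠ i → x j = y j
  symm := ⟨fun _ _ ⟨i, h, h'⟩ => ⟨i, h.symm, fun j hj => (h' j hj).symm⟩⟩
  loopless := ⟨fun _ ⟨_, h, _⟩ => h.ne rfl⟩

/-- The Cartesian power `G^t = G □ ⋯ □ G` (`t` factors). -/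
def cartPow {V : Type v} (G : SimpleGraph V) (t : ℕ) : SimpleGraph (Fin t → V) :=
  cartProd fun _ : Fin t => G

/-- The Cartesian power obeys the usual recursion `G^(t+1) = G □ G^t`. -/
def cartPowSuccIso {V : Type v} (G : SimpleGraph V) (t : ℕ) :
    G.cartPow (t + 1) ≃g G □ G.cartPow t where
  toEquiv := (Fin.consEquiv fun _ : Fin (t + 1) => V).symm
  map_rel_iff' := by
    intro x y
    simp [cartPow, cartProd, Fin.consEquiv, boxProd_adj, Fin.exists_fin_succ, Fin.forall_fin_succ,
      funext_iff, Fin.tail, (Fin.succ_ne_zero _).symm]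
    grind

/-- A graph is prime if it is not the Cartesian product of two graphs neither of which is
isomorphic to it. (With this wording a one-vertex graph counts as prime.) -/
def IsCartPrime {V : Type u} (G : SimpleGraph V) : Prop :=
  ∀ (A B : Type u) (H : SimpleGraph A) (K : SimpleGraph B),
    Nonempty (G ≃g H □ K) → Nonempty (G ≃g H) ∨ Nonempty (G ≃g K)

/-- A vertex coloring is distinguishing if only the identity automorphism preserves it. -/
def IsDistinguishing {V : Type u} {C : Type v} (G : SimpleGraph V) (c : V → C) : Prop :=
  ∀ φ : G ≃g G, (∀ x, c (φ x) = c x) → ∀ x, φ x = x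

/-- `t` is a positive number of colors such that, for every `k ≥ t`, every coloring with exactly
`k` colors is distinguishing. -/
def IsThresholdBound {V : Type u} (G : SimpleGraph V) (t : ℕ) : Prop :=
  1 ≤ t ∧ ∀ k, t ≤ k → ∀ c : V → Fin k, Function.Surjective c → G.IsDistinguishing c

/-- The distinguishing threshold `θ(G)`: the least positive `t` such that, for every `k ≥ t`,
every coloring with exactly `k` colors is distinguishing. -/
noncomputable def distinguishingThreshold {V : Type u} (G : SimpleGraph V) : ℕ :=
  sInf {t | G.IsThresholdBound t}

/-- On finite graphs the minimum in the definition of the threshold is attained. -/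
theorem isLeast_distinguishingThreshold {V : Type u} [Finite V] (G : SimpleGraph V) :
    IsLeast {t | G.IsThresholdBound t} G.distinguishingThreshold := by
  have hne : {t | G.IsThresholdBound t}.Nonempty := by
    refine ⟨Nat.card V + 1, by omega, fun k hk c hc => ?_⟩
    have h := Nat.card_le_card_of_surjective c hc
    rw [Nat.card_fin] at h
    omega
  exact ⟨Nat.sInf_mem hne, fun t ht => Nat.sInf_le ht⟩

end SimpleGraph

/-! A coloring preserved by an automorphism is constant on its cycles, and coloring by cycles is
itself preserved. So a threshold above 1 is one more than the largest number of cycles of a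
non-identity automorphism (`isThresholdBound_iff`). Automorphisms of the product act separately on
each block `G_i^{t_i}`: distances add over coordinates, so layers go to metrically closed boxes.
Primeness makes such a box vary in one coordinate (`exists_layer_subset`), and non-isomorphic
factors cannot be exchanged (`apply_congr_of_prime_powers`). If an automorphism moves block `i`,
representatives of its cycles there times all values of the other blocks meet every cycle. Acting on
block `i` alone attains this bound. -/

namespace SimpleGraph

/-! ### Metric structure of Cartesian products -/

section Product

open Function

variable {ι : Type*} {V : ι → Type*} {A : ∀ i, SimpleGraph (V i)}

theorem cartProd_adj_update [DecidableEq ι] (x : ∀ i, V i) (i : ι) (v w : V i) :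
    (cartProd A).Adj (update x i v) (update x i w) ↔ (A i).Adj v w := by
  constructor
  · rintro ⟨j, hj, -⟩
    rcases eq_or_ne j i with rfl | hne
    · simpa using hj
    · simp [hne] at hj
  · intro h
    exact ⟨i, by simpa using h, fun j hj => by simp [hj]⟩

theorem Reachable.cartProd_apply {x y : ∀ i, V i} (h : (cartProd A).Reachable x y) (i : ι) :
    (A i).Reachable (x i) (y i) := by
  obtain ⟨p⟩ := h
  induction p with
  | nil => exact Reachable.refl _
  | cons hadj _ ih =>
    obtain ⟨j, hj, hne⟩ := hadj
    rcases eq_or_ne i j with rfl | hij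
    · exact hj.reachable.trans ih
    · rwa [hne i hij]

theorem Connected.of_cartProd (h : (cartProd A).Connected) (i : ι) : (A i).Connected := by
  classical
  obtain ⟨a⟩ := h.nonempty
  refine { preconnected := fun v w => ?_, nonempty := ⟨a i⟩ }
  simpa using (h.preconnected (update a i v) (update a i w)).cartProd_apply i

theorem sum_dist_le_length [Fintype ι] (hA : ∀ i, (A i).Connected) {x y : ∀ i, V i}
    (p : (cartProd A).Walk x y) : ∑ i, (A i).dist (x i) (y i) ≤ p.length := by
  classical
  induction p with
  | nil => simp
  | @cons u v w hadj q ih =>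
    obtain ⟨j, hj, hne⟩ := hadj
    refine le_trans ?_ (Nat.add_le_add_right ih 1)
    rw [← Finset.add_sum_erase _ _ (Finset.mem_univ j),
      ← Finset.add_sum_erase (a := j) _ (fun i => (A i).dist (v i) (w i)) (Finset.mem_univ j)]
    have h1 : (A j).dist (u j) (w j) ≤ (A j).dist (v j) (w j) + 1 := by
      have := (hA j).dist_triangle (u := u j) (v := v j) (w := w j)
      rw [dist_eq_one_iff_adj.2 hj] at this
      omega
    have h2 : ∑ i ∈ Finset.univ.erase j, (A i).dist (u i) (w i) =
        ∑ i ∈ Finset.univ.erase j, (A i).dist (v i) (w i) :=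
      Finset.sum_congr rfl fun i hi => by rw [hne i (Finset.ne_of_mem_erase hi)]
    omega

theorem dist_update_le [DecidableEq ι] (hA : ∀ i, (A i).Connected) (x : ∀ i, V i) (i : ι)
    (v : V i) : (cartProd A).dist x (update x i v) ≤ (A i).dist (x i) v := by
  obtain ⟨p, hp⟩ := (hA i).exists_walk_length_eq_dist (x i) v
  let f : A i →g cartProd A := ⟨update x i, fun h => (cartProd_adj_update x i _ _).2 h⟩
  have h : (cartProd A).dist (update x i (x i)) (update x i v) ≤ (p.map f).length := dist_le _
  rwa [Walk.length_map, hp, update_eq_self] at h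

theorem dist_cartProd [Fintype ι] (hG : (cartProd A).Connected) (x y : ∀ i, V i) :
    (cartProd A).dist x y = ∑ i, (A i).dist (x i) (y i) := by
  classical
  have hA := hG.of_cartProd
  apply le_antisymm
  · suffices ∀ s : Finset ι, ∀ x : ∀ i, V i, (∀ i ∉ s, x i = y i) →
        (cartProd A).dist x y ≤ ∑ i ∈ s, (A i).dist (x i) (y i) from
      this Finset.univ x fun i hi => absurd (Finset.mem_univ i) hi
    intro s
    induction s using Finset.induction_on with
    | empty =>
      intro x hx
      obtain rfl : x = y := funext fun i => hx i (Finset.notMem_empty i)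
      simp
    | insert j s hj ih =>
      intro x hx
      rw [Finset.sum_insert hj]
      refine (hG.dist_triangle (v := update x j (y j))).trans
        (add_le_add (dist_update_le hA x j (y j)) ((ih _ fun i hi => ?_).trans_eq ?_))
      · rcases eq_or_ne i j with rfl | hij
        · simp
        · rw [update_of_ne hij]
          exact hx i (by simp [hij, hi])
      · refine Finset.sum_congr rfl fun i hi => ?_
        rw [update_of_ne (ne_of_mem_of_not_mem hi hj)]
  · obtain ⟨p, hp⟩ := hG.exists_walk_length_eq_dist x y
    exact hp ▸ sum_dist_le_length hA p

/-- A vertex thus has a unique nearest point in each layer, the one sharing its coordinate `i`. -/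
theorem dist_update_eq_add [DecidableEq ι] [Fintype ι] (hG : (cartProd A).Connected)
    (x a : ∀ i, V i) (i : ι) (v : V i) :
    (cartProd A).dist x (update a i v) =
      (cartProd A).dist x (update a i (x i)) + (A i).dist (x i) v := by
  have h : ∀ w, (cartProd A).dist x (update a i w) =
      (A i).dist (x i) w + ∑ l ∈ Finset.univ.erase i, (A l).dist (x l) (a l) := by
    intro w
    rw [dist_cartProd hG, ← Finset.add_sum_erase _ _ (Finset.mem_univ i), update_self]
    congr 1
    refine Finset.sum_congr rfl fun l hl => ?_
    rw [update_of_ne (Finset.ne_of_mem_erase hl)]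
  rw [h, h, dist_self]
  ring

theorem Iso.dist_apply {X Y : Type*} {G : SimpleGraph X} {H : SimpleGraph Y} (φ : G ≃g H)
    (hG : G.Connected) (x y : X) : H.dist (φ x) (φ y) = G.dist x y := by
  have hH : H.Connected := φ.connected_iff.1 hG
  apply le_antisymm
  · obtain ⟨p, hp⟩ := hG.exists_walk_length_eq_dist x y
    rw [← hp, ← Walk.length_map φ.toHom p]
    exact dist_le _
  · obtain ⟨p, hp⟩ := hH.exists_walk_length_eq_dist (φ x) (φ y)
    rw [← hp, ← Walk.length_map φ.symm.toHom p]
    have := dist_le (p.map φ.symm.toHom)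
    simpa using this

/-- The image of a layer under an automorphism is closed under exchanging coordinates. -/
theorem exists_apply_update_eq_update [DecidableEq ι] [Fintype ι] (hG : (cartProd A).Connected)
    (φ : cartProd A ≃g cartProd A) (a : ∀ i, V i) (i j : ι) (v w : V i) :
    ∃ u, φ (update a i u) = update (φ (update a i v)) j (φ (update a i w) j) := by
  set x := update a i v
  set y := update a i w
  set c := update (φ x) j (φ y j) with hc
  set z := φ.symm c
  have hA := hG.of_cartProd
  have hφz : φ z = c := φ.apply_symm_apply c
  -- Each coordinate of `c` comes from `φ x` or `φ y`, so `c` lies on a geodesic between them and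
  -- `z` on one from `x` to `y`.
  have hsum : (cartProd A).dist x z + (cartProd A).dist z y = (cartProd A).dist x y := by
    rw [← φ.dist_apply hG x z, ← φ.dist_apply hG z y, ← φ.dist_apply hG x y, hφz,
      dist_cartProd hG, dist_cartProd hG, dist_cartProd hG, ← Finset.sum_add_distrib]
    refine Finset.sum_congr rfl fun l _ => ?_
    rcases eq_or_ne l j with rfl | hl
    · simp [hc]
    · simp [hc, hl]
  rw [dist_cartProd hG, dist_cartProd hG, dist_cartProd hG, ← Finset.sum_add_distrib] at hsum
  -- Equality in the summed triangle inequalities forces it coordinatewise; off `i`, where `x` and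
  -- `y` agree, `z` must agree too.
  have hcoord := (Finset.sum_eq_sum_iff_of_le fun l _ =>
    (hA l).dist_triangle (u := x l) (v := z l) (w := y l)).1 hsum.symm
  refine ⟨z i, ?_⟩
  have hz : update a i (z i) = z := by
    funext l
    rcases eq_or_ne l i with rfl | hl
    · simp
    · have := hcoord l (Finset.mem_univ l)
      simp only [x, y, update_of_ne hl, dist_self] at this
      rw [update_of_ne hl]
      exact (hA l).dist_eq_zero_iff.1 (by omega)
  rw [hz, hφz]

end Product

/-! ### Prime factors and automorphisms -/

section Prime

open Function

universe u₁ u₂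

variable {ι : Type u₂} {V : ι → Type u₁} {A : ∀ i, SimpleGraph (V i)}

/-- A prime graph embedded as a box in a product varies in only one coordinate. -/
theorem IsCartPrime.exists_coordinate [DecidableEq ι] {X : Type*} [Finite X]
    {P : SimpleGraph X} (hP : P.IsCartPrime) {Y : ι → Type*} {B : ∀ i, SimpleGraph (Y i)}
    (f : P ↪g cartProd B) (hbox : ∀ v w j, ∃ u, f u = update (f v) j (f w j))
    {o v : X} {j : ι} (hne : f v j ≠ f o j) :
    ∀ w, ∀ l, l ≠ j → f w l = f o l := by
  let S : Set X := {w | ∀ l, l ≠ j → f w l = f o l}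
  let T : Set X := {w | f w j = f o j}
  -- `mix v w` takes coordinate `j` from `w` and the others from `v`; this splits `P` as `S □ T`.
  choose mix hmix using fun v w => hbox v w j
  have hS : ∀ w, mix o w ∈ S := fun w l hl => by rw [hmix, update_of_ne hl]
  have hT : ∀ w, mix w o ∈ T := fun w => by simp [T, hmix]
  let e : P ≃g (P.induce S) □ (P.induce T) :=
    { toFun := fun w => (⟨mix o w, hS w⟩, ⟨mix w o, hT w⟩)
      invFun := fun q => mix q.2 q.1
      left_inv := fun w => f.injective <| by
        funext l
        rcases eq_or_ne l j with rfl | hl <;> simp [*]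
      right_inv := by
        rintro ⟨⟨s, hs⟩, ⟨r, hr⟩⟩
        refine Prod.ext (Subtype.ext (f.injective ?_)) (Subtype.ext (f.injective ?_))
        · funext l
          rcases eq_or_ne l j with rfl | hl
          · simp [hmix]
          · simpa [hmix, hl] using (hs l hl).symm
        · funext l
          rcases eq_or_ne l j with rfl | hl
          · simpa [hmix] using (show f r l = f o l from hr).symm
          · simp [hmix, hl]
      map_rel_iff' := by
        intro w w'
        have hadj : ∀ p q, P.Adj p q ↔ (cartProd B).Adj (f p) (f q) :=
          fun p q => f.map_adj_iff.symm
        simp only [Equiv.coe_fn_mk, boxProd_adj, comap_adj, Function.Embedding.subtype_apply,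
          Subtype.mk.injEq, hadj, ← f.injective.eq_iff (a := mix w o),
          ← f.injective.eq_iff (a := mix o w), hmix, cartProd_adj_update]
        constructor
        · rintro (⟨h, h'⟩ | ⟨⟨l, h, h'⟩, h''⟩)
          · refine ⟨j, h, fun l hl => ?_⟩
            simpa [hl] using congrFun h' l
          · rcases eq_or_ne l j with rfl | hl
            · simp at h
            · refine ⟨l, by simpa [hl] using h, fun l' hl' => ?_⟩
              rcases eq_or_ne l' j with rfl | hl''
              · simpa using congrFun h'' l'
              · simpa [hl''] using h' l' hl'
        · rintro ⟨l, h, h'⟩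
          rcases eq_or_ne l j with rfl | hl
          · refine Or.inl ⟨h, ?_⟩
            funext l'
            rcases eq_or_ne l' l with rfl | hl'
            · simp
            · simpa [hl'] using h' l' hl'
          · refine Or.inr ⟨⟨l, by simpa [hl] using h, fun l' hl' => ?_⟩, by rw [h' j hl.symm]⟩
            rcases eq_or_ne l' j with rfl | hl''
            · simp
            · simpa [hl''] using h' l' hl' }
  -- By finiteness, an induced subgraph isomorphic to `P` is all of `P`. For `T` this contradicts
  -- `hne`.
  have full : ∀ U : Set X, Nonempty (P ≃g P.induce U) → ∀ w, w ∈ U := by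
    rintro U ⟨g⟩ w
    have hinj : Injective fun x => (g x : X) := Subtype.val_injective.comp g.injective
    obtain ⟨x, rfl⟩ := Finite.surjective_of_injective hinj w
    exact (g x).2
  rcases hP _ _ _ _ ⟨e⟩ with h | h
  · exact full S h
  · exact absurd (full T h v) hne

/-- Automorphisms map layers of prime factors into layers. -/
theorem exists_layer_subset [DecidableEq ι] [Fintype ι] (hG : (cartProd A).Connected)
    [∀ i, Finite (V i)] (hA : ∀ i, (A i).IsCartPrime) (φ : cartProd A ≃g cartProd A)
    (a : ∀ i, V i) (i : ι) :
    ∃ j, ∀ v, φ (update a i v) = update (φ a) j (φ (update a i v) j) := by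
  let f : A i ↪g cartProd A :=
    { toFun := fun v => φ (update a i v)
      inj' := φ.injective.comp (update_injective a i)
      map_rel_iff' := φ.map_adj_iff.trans (cartProd_adj_update a i _ _) }
  have ho : f (a i) = φ a := congrArg φ (update_eq_self i a)
  rcases subsingleton_or_nontrivial (V i) with h | h
  · refine ⟨i, fun v => ?_⟩
    rw [Subsingleton.elim v (a i), update_eq_self, update_eq_self]
  · obtain ⟨v, hv⟩ := exists_ne (a i)
    obtain ⟨j, hj⟩ := Function.ne_iff.1 (f.injective.ne hv)
    have := (hA i).exists_coordinate f
      (fun v w j => exists_apply_update_eq_update hG φ a i j v w) hj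
    refine ⟨j, fun w => funext fun l => ?_⟩
    rcases eq_or_ne l j with rfl | hl
    · simp
    · rw [update_of_ne hl, ← ho]
      exact this w l hl

/-- Each coordinate of an automorphism of a product of primes depends on a single coordinate,
belonging to an isomorphic factor. -/
theorem exists_iso_and_apply_congr [Finite ι] (hG : (cartProd A).Connected)
    [∀ i, Finite (V i)] (hA : ∀ i, (A i).IsCartPrime) (φ : cartProd A ≃g cartProd A) (j : ι) :
    ∃ i, Nonempty (A i ≃g A j) ∧ ∀ x y : ∀ i, V i, x i = y i → φ x j = φ y j := by
  classical
  have := Fintype.ofFinite ι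
  rcases subsingleton_or_nontrivial (V j) with hsub | hnt
  · exact ⟨j, ⟨Iso.refl⟩, fun x y _ => Subsingleton.elim _ _⟩
  obtain ⟨a⟩ := hG.nonempty
  obtain ⟨i, hi⟩ := exists_layer_subset hG hA φ.symm (φ a) j
  obtain ⟨j', hj'⟩ := exists_layer_subset hG hA φ a i
  rw [show φ.symm (φ a) = a from φ.symm_apply_apply a] at hi
  let g : V i → V j := fun v => φ (update a i v) j
  let h : V j → V i := fun w => φ.symm (update (φ a) j w) i
  have hh : ∀ w, φ (update a i (h w)) = update (φ a) j w := fun w => by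
    rw [← hi w]
    exact φ.apply_symm_apply _
  -- The `j`-layer through `φ a` has at least two vertices and lies in the image of an `i`-layer,
  -- which varies only in `j'`.
  obtain rfl : j = j' := by
    by_contra hne
    obtain ⟨v, hv⟩ := exists_ne (φ a j)
    have := congrFun (hj' (h v)) j
    rw [hh, update_self, update_of_ne hne] at this
    exact hv this
  have hgh : ∀ w, g (h w) = w := fun w => by simp [g, hh]
  have hhg : ∀ v, h (g v) = v := fun v => by
    apply update_injective a i
    apply φ.injective
    rw [hh, hj' v]
  refine ⟨i, ⟨⟨⟨g, h, hhg, hgh⟩, ?_⟩⟩, ?_⟩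
  · intro v w
    change (A j).Adj (g v) (g w) ↔ _
    rw [← cartProd_adj_update (φ a) j, ← hj' v, ← hj' w, φ.map_adj_iff, cartProd_adj_update]
  · suffices ∀ x : ∀ i, V i, φ x j = g (x i) by
      intro x y hxy
      rw [this, this, hxy]
    intro x
    -- Nearest points in corresponding layers are matched by `φ`: adding the two identities makes
    -- both extra distances vanish.
    have h1 := dist_update_eq_add hG x a i (h (φ x j))
    have h2 := dist_update_eq_add hG (φ x) (φ a) j (g (x i))
    rw [← hh (g (x i)), φ.dist_apply hG, hhg, ← hh (φ x j), φ.dist_apply hG] at h2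
    have h3 : x i = h (φ x j) := (hG.of_cartProd i).dist_eq_zero_iff.1 (by omega)
    rw [h3, hgh]

/-- A product of powers is the product over all the pairs of a factor and an exponent index. -/
def cartProdCartPowIso {κ : Type*} {U : κ → Type*} (F : ∀ i, SimpleGraph (U i)) (t : κ → ℕ) :
    cartProd (fun p : Σ i, Fin (t i) => F p.1) ≃g cartProd fun i => (F i).cartPow (t i) where
  toEquiv := Equiv.piCurry fun i (_ : Fin (t i)) => U i
  map_rel_iff' := by
    intro x y
    constructor
    · rintro ⟨i, ⟨s, h, h'⟩, h''⟩
      refine ⟨⟨i, s⟩, h, ?_⟩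
      rintro ⟨i', s'⟩ hne
      rcases eq_or_ne i' i with rfl | hi
      · exact h' s' (by rintro rfl; exact hne rfl)
      · exact congrFun (h'' i' hi) s'
    · rintro ⟨⟨i, s⟩, h, h'⟩
      refine ⟨i, ⟨s, h, fun s' hs => h' ⟨i, s'⟩ (by simpa using hs)⟩, fun i' hi => ?_⟩
      funext s'
      exact h' ⟨i', s'⟩ (fun heq => hi (congrArg Sigma.fst heq))

/-- Automorphisms of a product of powers of pairwise non-isomorphic primes act coordinatewise. -/
theorem apply_congr_of_prime_powers {κ : Type*} [Finite κ] {U : κ → Type u₁} [∀ i, Finite (U i)]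
    {F : ∀ i, SimpleGraph (U i)} {t : κ → ℕ} (hprime : ∀ i, (F i).IsCartPrime)
    (hdistinct : ∀ i j, i ≠ j → IsEmpty (F i ≃g F j))
    (hG : (cartProd fun i => (F i).cartPow (t i)).Connected)
    (φ : (cartProd fun i => (F i).cartPow (t i)) ≃g cartProd fun i => (F i).cartPow (t i))
    (i : κ) (x y : ∀ i, Fin (t i) → U i) (hxy : x i = y i) : φ x i = φ y i := by
  let e := cartProdCartPowIso F t
  have hG' : (cartProd fun p : Σ i, Fin (t i) => F p.1).Connected := e.connected_iff.2 hG
  funext s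
  obtain ⟨⟨i', s'⟩, ⟨g⟩, h⟩ := exists_iso_and_apply_congr hG' (fun p => hprime p.1)
    ((e.trans φ).trans e.symm) ⟨i, s⟩
  obtain rfl : i' = i := by
    by_contra hne
    exact (hdistinct _ _ hne).elim g
  have := h (e.symm x) (e.symm y) (congrFun hxy s')
  have hx : e (e.symm x) = x := e.apply_symm_apply x
  have hy : e (e.symm y) = y := e.apply_symm_apply y
  change φ (e (e.symm x)) i' s = φ (e (e.symm y)) i' s at this
  rwa [hx, hy] at this

end Prime

/-! ### Thresholds and cycle counts -/

section Threshold

open Function Equiv.Perm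

/-- The cycles of an automorphism, fixed points included. -/
abbrev Iso.Cycles {X : Type*} {G : SimpleGraph X} (φ : G ≃g G) : Type _ :=
  Quotient (SameCycle.setoid φ.toEquiv)

theorem Iso.cycles_apply {X : Type*} {G : SimpleGraph X} (φ : G ≃g G) (x : X) :
    (Quotient.mk _ (φ x) : φ.Cycles) = Quotient.mk _ x :=
  Quotient.sound (sameCycle_apply_left.2 (SameCycle.refl φ.toEquiv x))

theorem apply_zpow_eq {X C : Type*} {e : Equiv.Perm X} {c : X → C} (hc : ∀ x, c (e x) = c x)
    (n : ℤ) (x : X) : c ((e ^ n) x) = c x := by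
  induction n with
  | zero => rfl
  | succ n ih => rw [add_comm, zpow_add, zpow_one, mul_apply, hc, ih]
  | pred n ih =>
    rw [← ih, ← hc]
    congr 1
    rw [← mul_apply, ← zpow_one_add]
    congr 2
    ring

theorem apply_eq_of_sameCycle {X C : Type*} {e : Equiv.Perm X} {c : X → C}
    (hc : ∀ x, c (e x) = c x) {x y : X} (h : SameCycle e x y) : c x = c y := by
  obtain ⟨n, rfl⟩ := h
  exact (apply_zpow_eq hc n x).symm

theorem isThresholdBound_iff {X : Type*} [Finite X] (G : SimpleGraph X) (t : ℕ) :
    G.IsThresholdBound t ↔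
      1 ≤ t ∧ ∀ φ : G ≃g G, (∃ x, φ x ≠ x) → Nat.card φ.Cycles < t := by
  refine and_congr_right fun _ => ⟨fun h φ ⟨x, hx⟩ => ?_, fun h k hk c hc φ hφ x => ?_⟩
  · by_contra! hle
    let e : φ.Cycles ≃ Fin (Nat.card φ.Cycles) := Finite.equivFin _
    exact hx (h _ hle (fun y => e (Quotient.mk _ y)) (e.surjective.comp Quotient.mk_surjective) φ
      (fun y => congrArg e (φ.cycles_apply y)) x)
  · by_contra hx
    have hlt := h φ ⟨x, hx⟩
    let q : φ.Cycles → Fin k := Quotient.lift c fun _ _ hxy => apply_eq_of_sameCycle hφ hxy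
    have hq : Surjective q := fun b => (hc b).imp' (Quotient.mk _) fun _ => id
    have := Nat.card_le_card_of_surjective q hq
    rw [Nat.card_fin] at this
    omega

theorem one_le_distinguishingThreshold {X : Type*} [Finite X] (G : SimpleGraph X) :
    1 ≤ G.distinguishingThreshold :=
  G.isLeast_distinguishingThreshold.1.1

theorem card_cycles_lt_distinguishingThreshold {X : Type*} [Finite X] {G : SimpleGraph X}
    (φ : G ≃g G) (hφ : ∃ x, φ x ≠ x) : Nat.card φ.Cycles < G.distinguishingThreshold :=
  ((isThresholdBound_iff G _).1 G.isLeast_distinguishingThreshold.1).2 φ hφ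

theorem exists_card_cycles_eq {X : Type*} [Finite X] (G : SimpleGraph X)
    (h : 2 ≤ G.distinguishingThreshold) :
    ∃ φ : G ≃g G, (∃ x, φ x ≠ x) ∧ G.distinguishingThreshold = Nat.card φ.Cycles + 1 := by
  have hnot : ¬ G.IsThresholdBound (G.distinguishingThreshold - 1) := fun hb => by
    have := G.isLeast_distinguishingThreshold.2 hb
    omega
  rw [isThresholdBound_iff] at hnot
  push Not at hnot
  obtain ⟨φ, hφ, hle⟩ := hnot (by omega)
  have := card_cycles_lt_distinguishingThreshold φ hφ
  exact ⟨φ, hφ, by omega⟩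

theorem IsThresholdBound.of_iso {X Y : Type*} {G : SimpleGraph X} {H : SimpleGraph Y}
    (e : G ≃g H) {t : ℕ} (h : G.IsThresholdBound t) : H.IsThresholdBound t := by
  refine ⟨h.1, fun k hk c hc φ hφ y => ?_⟩
  have := h.2 k hk (c ∘ e) (hc.comp e.surjective) ((e.trans φ).trans e.symm)
    (fun x => by simp [hφ]) (e.symm y)
  simpa using this

theorem Iso.distinguishingThreshold_eq {X Y : Type*} {G : SimpleGraph X} {H : SimpleGraph Y}
    (e : G ≃g H) : G.distinguishingThreshold = H.distinguishingThreshold :=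
  congrArg sInf (Set.ext fun _ => ⟨.of_iso e, .of_iso e.symm⟩)

variable {ι : Type*} {X : ι → Type*} {H : ∀ i, SimpleGraph (X i)}

/-- The automorphism of a product acting on a single coordinate. -/
def cartProdUpdateIso [DecidableEq ι] (i : ι) (ψ : H i ≃g H i) : cartProd H ≃g cartProd H where
  toFun x := update x i (ψ (x i))
  invFun x := update x i (ψ.symm (x i))
  left_inv x := by simp
  right_inv x := by simp
  map_rel_iff' := by
    intro x y
    refine exists_congr fun j => and_congr ?_ (forall_congr' fun l => imp_congr_right fun _ => ?_)
    · rcases eq_or_ne j i with rfl | hj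
      · simpa using ψ.map_adj_iff
      · simp [hj]
    · rcases eq_or_ne l i with rfl | hl <;> simp [*]

/-- The cycle of coordinate `i` and the values of all other coordinates are invariants of the lifted
automorphism. -/
theorem card_mul_card_le_card_cycles [DecidableEq ι] [Finite ι] [∀ i, Finite (X i)] (i : ι)
    (ψ : H i ≃g H i) :
    Nat.card ψ.Cycles * Nat.card (∀ j : {j // j ≠ i}, X j) ≤
      Nat.card (cartProdUpdateIso i ψ).Cycles := by
  rw [← Nat.card_prod]
  let c : (∀ i, X i) → ψ.Cycles × ∀ j : {j // j ≠ i}, X j :=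
    fun x => (Quotient.mk _ (x i), fun j => x j)
  have hc : ∀ x, c (cartProdUpdateIso i ψ x) = c x := by
    intro x
    refine Prod.ext ?_ (funext fun j => update_of_ne j.2 _ _)
    change Quotient.mk _ (update x i (ψ (x i)) i) = Quotient.mk _ (x i)
    rw [update_self]
    exact ψ.cycles_apply (x i)
  let q : (cartProdUpdateIso i ψ).Cycles → ψ.Cycles × ∀ j : {j // j ≠ i}, X j :=
    Quotient.lift c fun _ _ hxy => apply_eq_of_sameCycle hc hxy
  refine Nat.card_le_card_of_surjective q ?_
  rintro ⟨⟨v⟩, r⟩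
  refine ⟨Quotient.mk _ ((Equiv.piSplitAt i X).symm (v, r)), ?_⟩
  refine Prod.ext ?_ (funext fun j => ?_)
  · change Quotient.mk _ _ = Quotient.mk _ v
    simp [Equiv.piSplitAt]
  · change (Equiv.piSplitAt i X).symm (v, r) j = r j
    simp [Equiv.piSplitAt, j.2]

theorem card_cycles_le_card_mul_card [DecidableEq ι] [Finite ι] [∀ i, Finite (X i)] (i : ι)
    (φ : cartProd H ≃g cartProd H) (ψ : H i ≃g H i) (h : ∀ x, φ x i = ψ (x i)) :
    Nat.card φ.Cycles ≤ Nat.card ψ.Cycles * Nat.card (∀ j : {j // j ≠ i}, X j) := by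
  rw [← Nat.card_prod]
  let q : (ψ.Cycles × ∀ j : {j // j ≠ i}, X j) → φ.Cycles :=
    fun p => Quotient.mk _ ((Equiv.piSplitAt i X).symm (p.1.out, p.2))
  refine Nat.card_le_card_of_surjective q ?_
  rintro ⟨x⟩
  have hpow : ∀ n : ℕ, ((φ.toEquiv ^ n) x) i = (ψ.toEquiv ^ n) (x i) := by
    intro n
    induction n with
    | zero => rfl
    | succ n ih =>
      rw [pow_succ', pow_succ', mul_apply, mul_apply, ← ih]
      exact h _
  have hout : SameCycle ψ.toEquiv (x i) (Quotient.mk (SameCycle.setoid ψ.toEquiv) (x i)).out :=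
    (Quotient.mk_out (s := SameCycle.setoid ψ.toEquiv) (x i)).symm
  -- Moving along the cycle of `x` brings coordinate `i` to its chosen representative.
  obtain ⟨n, hn⟩ := hout.exists_nat_pow_eq
  refine ⟨(Quotient.mk _ (x i), fun j => (φ.toEquiv ^ n) x j), ?_⟩
  have heq : (Equiv.piSplitAt i X).symm ((Quotient.mk (SameCycle.setoid ψ.toEquiv) (x i)).out,
      fun j => (φ.toEquiv ^ n) x j) = (φ.toEquiv ^ n) x := by
    rw [Equiv.symm_apply_eq]
    exact Prod.ext (by rw [← hn, ← hpow n]; rfl) rfl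
  change Quotient.mk _ _ = Quotient.mk _ x
  rw [heq]
  exact Quotient.sound (SameCycle.symm ⟨n, by simp⟩)

/-- An automorphism acting coordinatewise induces automorphisms of the factors. -/
theorem exists_iso_apply_eq [DecidableEq ι] [Nonempty (∀ i, X i)]
    (hco : ∀ (φ : cartProd H ≃g cartProd H) (i : ι) (x y : ∀ i, X i), x i = y i → φ x i = φ y i)
    (φ : cartProd H ≃g cartProd H) (i : ι) :
    ∃ ψ : H i ≃g H i, ∀ x, φ x i = ψ (x i) := by
  obtain ⟨a⟩ := ‹Nonempty (∀ i, X i)›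
  let g : (cartProd H ≃g cartProd H) → X i → X i := fun σ v => σ (update a i v) i
  have hg : ∀ σ x, σ x i = g σ (x i) := fun σ x => hco σ i _ _ (by simp)
  have hinv : ∀ σ v, g σ.symm (g σ v) = v := fun σ v => by
    change g σ.symm (σ (update a i v) i) = v
    rw [← hg]
    simp
  have hadj : ∀ σ v w, (H i).Adj v w → (H i).Adj (g σ v) (g σ w) := by
    intro σ v w hvw
    obtain ⟨j, hj, -⟩ := σ.map_adj_iff.2 ((cartProd_adj_update a i v w).2 hvw)
    rcases eq_or_ne j i with rfl | hne
    · exact hj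
    -- An edge in direction `j ≠ i` is impossible: the two arguments agree at `j`, hence so do their
    -- images.
    · exact absurd (hco σ j _ _ (by simp [hne])) hj.ne
  refine ⟨⟨⟨g φ, g φ.symm, hinv φ, hinv φ.symm⟩, fun {v w} => ⟨fun h => ?_, hadj φ v w⟩⟩, hg φ⟩
  simpa only [hinv] using hadj φ.symm (g φ v) (g φ w) h

/-- The distinguishing threshold of a product all of whose automorphisms act coordinatewise. -/
theorem isGreatest_distinguishingThreshold_cartProd [Finite ι] [Nonempty ι] [∀ i, Finite (X i)]
    [∀ i, Nonempty (X i)]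
    (hco : ∀ (φ : cartProd H ≃g cartProd H) (i : ι) (x y : ∀ i, X i), x i = y i → φ x i = φ y i) :
    IsGreatest
      (Set.range fun i : ι => ((H i).distinguishingThreshold - 1 : ℚ) *
        ((Nat.card (∀ i, X i) : ℚ) / (Nat.card (X i) : ℚ)) + 1)
      ((cartProd H).distinguishingThreshold : ℚ) := by
  classical
  have hone : ∀ i, 1 ≤ (H i).distinguishingThreshold := fun i => one_le_distinguishingThreshold _
  have hG := one_le_distinguishingThreshold (cartProd H)
  have hval : ∀ i, ((H i).distinguishingThreshold - 1 : ℚ) *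
      ((Nat.card (∀ i, X i) : ℚ) / (Nat.card (X i) : ℚ)) + 1 =
      (((H i).distinguishingThreshold - 1) * Nat.card (∀ j : {j // j ≠ i}, X j) + 1 : ℕ) := by
    intro i
    have h0 : (Nat.card (X i) : ℚ) ≠ 0 := Nat.cast_ne_zero.2 Nat.card_pos.ne'
    rw [Nat.card_congr (Equiv.piSplitAt i X), Nat.card_prod]
    push_cast [Nat.cast_sub (hone i)]
    rw [mul_div_cancel_left₀ _ h0]
  have hle : ∀ i, ((H i).distinguishingThreshold - 1) * Nat.card (∀ j : {j // j ≠ i}, X j) + 1 ≤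
      (cartProd H).distinguishingThreshold := by
    intro i
    rcases (hone i).eq_or_lt with h1 | h2
    · rw [← h1]
      simpa using hG
    · obtain ⟨ψ, ⟨v, hv⟩, heq⟩ := exists_card_cycles_eq (H i) h2
      rw [heq, Nat.add_sub_cancel]
      obtain ⟨a⟩ : Nonempty (∀ i, X i) := inferInstance
      refine (card_mul_card_le_card_cycles i ψ).trans_lt
        (card_cycles_lt_distinguishingThreshold _ ⟨update a i v, fun h => hv ?_⟩)
      have hi : update (update a i v) i (ψ (update a i v i)) i = update a i v i := congrFun h i
      simpa using hi
  constructor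
  · suffices ∃ i, (cartProd H).distinguishingThreshold ≤
        ((H i).distinguishingThreshold - 1) * Nat.card (∀ j : {j // j ≠ i}, X j) + 1 by
      obtain ⟨i, hi⟩ := this
      exact ⟨i, (hval i).trans (congrArg _ ((hle i).antisymm hi))⟩
    rcases hG.eq_or_lt with h1 | h2
    -- At threshold 1 every index works, since the right side is at least 1.
    · exact ⟨Classical.arbitrary ι, by omega⟩
    · obtain ⟨φ, ⟨x, hx⟩, heq⟩ := exists_card_cycles_eq (cartProd H) h2
      obtain ⟨i, hi⟩ := Function.ne_iff.1 hx
      obtain ⟨ψ, hψ⟩ := exists_iso_apply_eq hco φ i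
      have hlt := card_cycles_lt_distinguishingThreshold ψ ⟨x i, by rwa [← hψ]⟩
      refine ⟨i, ?_⟩
      rw [heq]
      exact Nat.add_le_add_right ((card_cycles_le_card_mul_card i φ ψ hψ).trans
        (Nat.mul_le_mul_right _ (by omega))) 1
  · rintro _ ⟨i, rfl⟩
    rw [show (fun i : ι => ((H i).distinguishingThreshold - 1 : ℚ) *
      ((Nat.card (∀ i, X i) : ℚ) / (Nat.card (X i) : ℚ)) + 1) i = _ from hval i]
    exact_mod_cast hle i

end Threshold

end SimpleGraph

theorem theorem4p3 {W : Type w} (G : SimpleGraph W) (hconn : G.Connected)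
    (k : ℕ) (hk : 1 ≤ k) {V : Fin k → Type u} [∀ i, Finite (V i)]
    (F : ∀ i, SimpleGraph (V i)) (t : Fin k → ℕ) (ht : ∀ i, 1 ≤ t i)
    (hprime : ∀ i, (F i).IsCartPrime)
    (hdistinct : ∀ i j, i ≠ j → IsEmpty (F i ≃g F j))
    (hG : Nonempty (G ≃g SimpleGraph.cartProd fun i => (F i).cartPow (t i))) :
    IsGreatest
      (Set.range fun i : Fin k =>
        (((F i).cartPow (t i)).distinguishingThreshold - 1 : ℚ) *
          ((Nat.card W : ℚ) / (Nat.card (Fin (t i) → V i) : ℚ)) + 1)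
      (G.distinguishingThreshold : ℚ) := by
  obtain ⟨e⟩ := hG
  have hconn' := e.connected_iff.1 hconn
  have : Nonempty (Fin k) := ⟨⟨0, hk⟩⟩
  have : ∀ i, Nonempty (Fin (t i) → V i) := fun i => hconn'.nonempty.map fun a => a i
  rw [e.distinguishingThreshold_eq, Nat.card_congr e.toEquiv]
  exact SimpleGraph.isGreatest_distinguishingThreshold_cartProd
    (SimpleGraph.apply_congr_of_prime_powers hprime hdistinct hconn')
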